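/- Let $\mathbb{T}=\mathbb{R}/\mathbb{Z}$ with normalized Haar measure, and for $f\in L^1(\mathbb{T})$ (complex-valued) let $\widehat f(n)=\int_{\mathbb{T}} f(\theta)e^{-2\pi i n\theta}\,d\theta$, $n\in\mathbb{Z}$. Let $H^1(\mathbb{T})$ be the (real) Hardy space of all $f\in L^1(\mathbb{T})$ whose periodic Hilbert transform $Hf$ is in $L^1(\mathbb{T})$, i.e. for which there is $g\in L^1(\mathbb{T})$ with $\widehat g(n)=-i\,\mathrm{sgn}(n)\widehat f(n)$ for all $n\in\mathbb{Z}$ (where $\mathrm{sgn}(0)=0$). Let $L\log^{1/2}L(\mathbb{T})$ be the space of all $f\in L^1(\mathbb{T})$ with $\int_{\mathbb{T}}|f|\log^{1/2}(1+|f|)\,d\theta<\infty$. For a subspace $X$ of $L^1(\mathbb{T})$, let $\mathcal{M}_{X\to L^2(\mathbb{T})}$ be the class of all $m\in\ell^\infty(\mathbb{Z})$ such that $\sum_{n\in\mathbb{Z}}|m(n)\widehat f(n)|^2<\infty$ for every $f\in X$. **Theorem.** Every multiplier from $H^1(\mathbb{T})$ to $L^2(\mathbb{T})$ is a multiplier from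 $L\log^{1/2}L(\mathbb{T})$ to $L^2(\mathbb{T})$, and the inclusion is proper: $$\mathcal{M}_{H^1(\mathbb{T})\to L^2(\mathbb{T})}\subsetneq \mathcal{M}_{L\log^{1/2}L(\mathbb{T})\to L^2(\mathbb{T})}.$$ -/

import Mathlib

open MeasureTheory AddCircle
open scoped ENNReal

namespace TorusMultiplier

/-- `L¹(𝕋)`: complex-valued integrable functions (modulo a.e. equality) on the circle
`𝕋 = ℝ/ℤ` with its normalized Haar measure. -/
abbrev L1 : Type := Lp ℂ 1 (haarAddCircle : Measure UnitAddCircle)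

/-- `g ∈ L¹(𝕋)` is the periodic Hilbert transform (conjugate function) of `f ∈ L¹(𝕋)`.
For `f ∈ L¹(𝕋)` the Hilbert transform `H f` is the distribution with Fourier coefficients
`-i sgn(n) f̂(n)`; the predicate says that this distribution is the integrable function `g`. -/
def IsHilbertTransform (f g : L1) : Prop :=
  ∀ n : ℤ, fourierCoeff g n = -Complex.I * ((Int.sign n : ℤ) : ℂ) * fourierCoeff f n

/-- The (real) Hardy space `H¹(𝕋)`: integrable functions whose Hilbert transform is integrable. -/
def hardySpace : Set L1 :=
  {f | ∃ g : L1, IsHilbertTransform f g}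

/-- The space `L log^r L (𝕋)`: all `f` with `∫ |f| log^r (1 + |f|) < ∞`. -/
def LlogL (r : ℝ) : Set L1 :=
  {f | Integrable (fun x => ‖f x‖ * Real.log (1 + ‖f x‖) ^ r) haarAddCircle}

/-- The class of multipliers from `X ⊆ L¹(𝕋)` to `L²(𝕋)`: all `m ∈ ℓ^∞(ℤ)` such that
`∑ |m(n) f̂(n)|² < ∞` for every `f ∈ X`. -/
def multipliers (X : Set L1) : Set (ℤ → ℂ) :=
  {m | Memℓp m ∞ ∧ ∀ f ∈ X, Summable (fun n : ℤ => ‖m n * fourierCoeff f n‖ ^ 2)}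

end TorusMultiplier

namespace TorusMultiplier

/-! Both halves turn on `DyadicallyBounded`: uniform control of the square sums of m over signed
dyadic blocks. It is necessary for H¹ multipliers and sufficient, but not necessary, for L log^{1/2}
L multipliers.

Sufficiency rests on Zygmund's inequality `exists_sum_sq_fourierCoeff_le`: Fourier coefficients of
an L log^{1/2} L function along a lacunary set are square summable. By duality this is the
exponential square integrability of lacunary sums, proved with Riesz products. Choosing the largest
coefficient in every second block gives a lacunary set, so the blockwise maxima are square summable
and can be paired with the block bounds on m.

Necessity is a condensation argument: if some block sums were huge, a weighted sum of one-sided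
Fejér kernels adapted to those blocks would lie in H¹ and violate summability.

The inclusion is proper because Zygmund's bound is uniform under frequency translation, whereas a
translated lacunary set may crowd into a single dyadic block. -/

lemma fourierCoeff_fourier_mul (f : UnitAddCircle → ℂ) (a m : ℤ) :
    fourierCoeff (fun x => fourier a x * f x) m = fourierCoeff f (m - a) := by
  unfold fourierCoeff
  congr 1
  ext x
  rw [show -(m - a) = -m + a by ring, fourier_add, smul_eq_mul, smul_eq_mul, mul_assoc]

lemma integrable_of_continuous {E : Type*} [NormedAddCommGroup E]
    {f : UnitAddCircle → E} (hf : Continuous f) : Integrable f haarAddCircle :=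
  hf.integrable_of_hasCompactSupport (HasCompactSupport.of_compactSpace f)

/-! ### Riesz products -/

/-- A three-term factor of a generalized Riesz product. -/
noncomputable def rieszFactor (n : ℕ → ℤ) (A v w : ℕ → ℂ) (j : ℕ) (x : UnitAddCircle) : ℂ :=
  A j + v j * fourier (n j) x + w j * fourier (-n j) x

lemma continuous_rieszFactor (n : ℕ → ℤ) (A v w : ℕ → ℂ) (j : ℕ) :
    Continuous (rieszFactor n A v w j) := by
  unfold rieszFactor
  exact (continuous_const.add (continuous_const.mul (map_continuous (fourier (n j))))).add
    (continuous_const.mul (map_continuous (fourier (-n j))))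

/-- The partial product has spectrum within the sum of the earlier |n j|. The next frequency exceeds
that sum, so shifting by ± n K cannot bring any of this spectrum to 0, and only the constants A j
contribute there. -/
lemma fourierCoeff_prod_rieszFactor {n : ℕ → ℤ}
    (hn : ∀ k, ∑ j ∈ Finset.range k, |n j| < |n k|) (A v w : ℕ → ℂ) (K : ℕ) :
    (∀ m : ℤ, ∑ j ∈ Finset.range K, |n j| < |m| →
      fourierCoeff (fun x => ∏ j ∈ Finset.range K, rieszFactor n A v w j x) m = 0) ∧
    fourierCoeff (fun x => ∏ j ∈ Finset.range K, rieszFactor n A v w j x) 0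
      = ∏ j ∈ Finset.range K, A j := by
  induction K with
  | zero =>
    have h : (fun _ : UnitAddCircle => (1 : ℂ)) = fourier (T := (1 : ℝ)) 0 := by
      ext x; simp
    simp only [Finset.range_zero, Finset.sum_empty, Finset.prod_empty]
    rw [h, fourierCoeff_fourier]
    refine ⟨fun m hm => ?_, by simp⟩
    rw [Pi.single_eq_of_ne]
    exact abs_pos.mp hm
  | succ K ih =>
    set P : UnitAddCircle → ℂ := fun x => ∏ j ∈ Finset.range K, rieszFactor n A v w j x with hP
    have hPc : Continuous P := continuous_finsetProd _ fun j _ => continuous_rieszFactor n A v w j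
    have key : ∀ m : ℤ,
        fourierCoeff (fun x => ∏ j ∈ Finset.range (K + 1), rieszFactor n A v w j x) m =
          A K * fourierCoeff P m + v K * fourierCoeff P (m - n K)
            + w K * fourierCoeff P (m + n K) := by
      intro m
      have e : (fun x => ∏ j ∈ Finset.range (K + 1), rieszFactor n A v w j x) =
          (fun x => A K * P x) + (fun x => v K * (fourier (n K) x * P x))
            + (fun x => w K * (fourier (-n K) x * P x)) := by
        ext x
        simp only [Finset.prod_range_succ, Pi.add_apply, hP, rieszFactor]
        ring
      have c1 : Continuous (fun x => A K * P x) := continuous_const.mul hPc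
      have c2 : Continuous (fun x => v K * (fourier (n K) x * P x)) :=
        continuous_const.mul ((map_continuous (fourier (n K))).mul hPc)
      have c3 : Continuous (fun x => w K * (fourier (-n K) x * P x)) :=
        continuous_const.mul ((map_continuous (fourier (-n K))).mul hPc)
      rw [e, fourierCoeff.add (integrable_of_continuous (c1.add c2))
          (integrable_of_continuous c3),
        fourierCoeff.add (integrable_of_continuous c1)
          (integrable_of_continuous c2)]
      simp only [Pi.add_apply, fourierCoeff.const_mul, fourierCoeff_fourier_mul, sub_neg_eq_add]
    have hs : 0 ≤ ∑ j ∈ Finset.range K, |n j| := Finset.sum_nonneg fun _ _ => abs_nonneg _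
    constructor
    · intro m hm
      rw [Finset.sum_range_succ] at hm
      rw [key, ih.1 m (by have := abs_nonneg (n K); omega),
        ih.1 (m - n K) (by have := abs_sub_abs_le_abs_sub m (n K); omega),
        ih.1 (m + n K) (by have := abs_sub_abs_le_abs_sub m (-n K); simp at this; omega)]
      simp
    · rw [key, ih.2, ih.1 (0 - n K) (by simpa using hn K), ih.1 (0 + n K) (by simpa using hn K),
        Finset.prod_range_succ]
      ring

lemma integral_prod_riesz {n : ℕ → ℤ} (hn : ∀ k, ∑ j ∈ Finset.range k, |n j| < |n k|)
    (A : ℕ → ℝ) (v : ℕ → ℂ) (K : ℕ) :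
    ∫ x : UnitAddCircle, ∏ j ∈ Finset.range K, (A j + (v j * fourier (n j) x).re) ∂haarAddCircle
      = ∏ j ∈ Finset.range K, A j := by
  -- Conjugate coefficients with halves, since Re z = (z + conj z)/2.
  have h := (fourierCoeff_prod_rieszFactor hn (fun j => (A j : ℂ)) (fun j => v j / 2)
    (fun j => (starRingEnd ℂ) (v j) / 2) K).2
  rw [fourierCoeff] at h
  have e : ∀ x : UnitAddCircle, ∏ j ∈ Finset.range K, rieszFactor n (fun j => (A j : ℂ))
      (fun j => v j / 2) (fun j => (starRingEnd ℂ) (v j) / 2) j x =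
      ((∏ j ∈ Finset.range K, (A j + (v j * fourier (n j) x).re) : ℝ) : ℂ) := by
    intro x
    rw [Complex.ofReal_prod]
    refine Finset.prod_congr rfl fun j _ => ?_
    rw [rieszFactor, Complex.ofReal_add, Complex.re_eq_add_conj, map_mul, fourier_neg]
    ring
  simp only [neg_zero, fourier_zero, one_smul, e] at h
  rw [integral_complex_ofReal] at h
  exact_mod_cast h

/-! ### Exponential integrability of lacunary sums -/

/-- By convexity, exp lies below its chord on the interval of radius |t|‖c‖. The chord is affine in
the real part, which makes the bound a Riesz factor with constant term cosh. -/
lemma exp_re_le (c z : ℂ) (hz : ‖z‖ = 1) (t : ℝ) :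
    Real.exp (t * (c * z).re) ≤
      Real.cosh (t * ‖c‖) + ((Real.sinh (t * ‖c‖) : ℂ) * (c / ‖c‖) * z).re := by
  have hu : |(c / ‖c‖ * z).re| ≤ 1 := by
    refine (Complex.abs_re_le_norm _).trans ?_
    rw [norm_mul, hz, mul_one, norm_div, Complex.norm_real, norm_norm]
    exact div_self_le_one _
  have h := Real.exp_mul_le_cosh_add_mul_sinh hu (t * ‖c‖)
  have e1 : (c / ‖c‖ * z).re * (t * ‖c‖) = t * (c * z).re := by
    have : (c * z).re = ‖c‖ * (c / ‖c‖ * z).re := by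
      rw [← Complex.re_ofReal_mul]
      by_cases hc : c = 0
      · simp [hc]
      · have : (‖c‖ : ℂ) ≠ 0 := by simpa using hc
        congr 1
        field_simp
    rw [this]; ring
  rw [e1] at h
  rw [mul_assoc, Complex.re_ofReal_mul]
  linarith

/-- Lacunary sums are subgaussian. -/
lemma integral_exp_lacunary_le {n : ℕ → ℤ} (hn : ∀ k, ∑ j ∈ Finset.range k, |n j| < |n k|)
    (c : ℕ → ℂ) (K : ℕ) (hc : ∑ j ∈ Finset.range K, ‖c j‖ ^ 2 ≤ 1) (t : ℝ) :
    ∫ x : UnitAddCircle, Real.exp (t * (∑ j ∈ Finset.range K, c j * fourier (n j) x).re)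
      ∂haarAddCircle ≤ Real.exp (t ^ 2 / 2) := by
  have hcont : ∀ j, Continuous fun x : UnitAddCircle => c j * fourier (n j) x := fun j =>
    continuous_const.mul (map_continuous (fourier (n j)))
  calc _ ≤ ∫ x : UnitAddCircle, ∏ j ∈ Finset.range K, (Real.cosh (t * ‖c j‖) +
        (((Real.sinh (t * ‖c j‖) : ℂ) * (c j / ‖c j‖)) * fourier (n j) x).re) ∂haarAddCircle := by
        refine integral_mono ?_ ?_ fun x => ?_
        · exact integrable_of_continuous (Real.continuous_exp.comp
            (continuous_const.mul (Complex.continuous_re.comp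
              (continuous_finsetSum _ fun j _ => hcont j))))
        · exact integrable_of_continuous (continuous_finsetProd _ fun j _ =>
            continuous_const.add (Complex.continuous_re.comp
              (continuous_const.mul (map_continuous (fourier (n j))))))
        · simp only
          rw [Complex.re_sum, Finset.mul_sum, Real.exp_sum]
          refine Finset.prod_le_prod (fun _ _ => (Real.exp_pos _).le) fun j _ => ?_
          exact exp_re_le (c j) (fourier (n j) x) (by rw [fourier_apply, Circle.norm_coe]) t
    _ = ∏ j ∈ Finset.range K, Real.cosh (t * ‖c j‖) := integral_prod_riesz hn _ _ K
    _ ≤ ∏ j ∈ Finset.range K, Real.exp ((t * ‖c j‖) ^ 2 / 2) :=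
        Finset.prod_le_prod (fun _ _ => (Real.cosh_pos _).le) fun j _ =>
          Real.cosh_le_exp_half_sq _
    _ = Real.exp (t ^ 2 / 2 * ∑ j ∈ Finset.range K, ‖c j‖ ^ 2) := by
        rw [← Real.exp_sum, Finset.mul_sum]
        congr 1
        exact Finset.sum_congr rfl fun j _ => by ring
    _ ≤ _ := by
        apply Real.exp_le_exp.mpr
        nlinarith [sq_nonneg t]

lemma integrable_exp_mul_sub_sq (r : ℝ) : Integrable fun t : ℝ => Real.exp (t * r - t ^ 2) := by
  have h := ((integrable_exp_neg_mul_sq one_pos).comp_sub_right (r / 2)).const_mul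
    (Real.exp (r ^ 2 / 4))
  refine h.congr (Filter.Eventually.of_forall fun t => ?_)
  simp only [← Real.exp_add]
  congr 1; ring

/-- Completing the square writes exp(r²/4) as a Gaussian average of exp(t r), so bounds on
exponential moments pass to the square exponential. -/
lemma integral_exp_mul_sub_sq (r : ℝ) :
    ∫ t : ℝ, Real.exp (t * r - t ^ 2) = Real.exp (r ^ 2 / 4) * √Real.pi := by
  have e : ∀ t : ℝ, Real.exp (t * r - t ^ 2)
      = Real.exp (r ^ 2 / 4) * Real.exp (-1 * (t - r / 2) ^ 2) := fun t => by
    rw [← Real.exp_add]; congr 1; ring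
  simp_rw [e]
  rw [integral_const_mul, integral_sub_right_eq_self (fun t : ℝ => Real.exp (-1 * t ^ 2)),
    integral_gaussian, div_one]

/-- A subgaussian random variable has a square exponential moment. -/
lemma lintegral_exp_sq_le {Ω : Type*} [MeasurableSpace Ω] {μ : Measure Ω} [IsProbabilityMeasure μ]
    {r : Ω → ℝ} (hr : Measurable r)
    (h : ∀ t : ℝ, ∫⁻ x, ENNReal.ofReal (Real.exp (t * r x)) ∂μ ≤
      ENNReal.ofReal (Real.exp (t ^ 2 / 2))) :
    ∫⁻ x, ENNReal.ofReal (Real.exp (r x ^ 2 / 4)) ∂μ ≤ 2 := by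
  have hpi : 0 < √Real.pi := Real.sqrt_pos.mpr Real.pi_pos
  have e : ∀ x, ENNReal.ofReal (Real.exp (r x ^ 2 / 4)) * ENNReal.ofReal (√Real.pi) =
      ∫⁻ t : ℝ, ENNReal.ofReal (Real.exp (-t ^ 2)) * ENNReal.ofReal (Real.exp (t * r x)) := by
    intro x
    rw [← ENNReal.ofReal_mul (Real.exp_pos _).le, ← integral_exp_mul_sub_sq,
      ofReal_integral_eq_lintegral_ofReal (integrable_exp_mul_sub_sq _)
        (Filter.Eventually.of_forall fun _ => (Real.exp_pos _).le)]
    refine lintegral_congr fun t => ?_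
    rw [← ENNReal.ofReal_mul (Real.exp_pos _).le, ← Real.exp_add]
    congr 2; ring
  have hm : AEMeasurable (Function.uncurry fun (x : Ω) (t : ℝ) =>
      ENNReal.ofReal (Real.exp (-t ^ 2)) * ENNReal.ofReal (Real.exp (t * r x)))
      (μ.prod volume) := by
    have h1 : Measurable fun p : Ω × ℝ => r p.1 := hr.comp measurable_fst
    apply Measurable.aemeasurable
    unfold Function.uncurry
    fun_prop
  have main : (∫⁻ x, ENNReal.ofReal (Real.exp (r x ^ 2 / 4)) ∂μ) * ENNReal.ofReal (√Real.pi)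
      ≤ 2 * ENNReal.ofReal (√Real.pi) := by
    rw [← lintegral_mul_const' _ _ ENNReal.ofReal_ne_top]
    simp_rw [e]
    rw [lintegral_lintegral_swap hm]
    calc _ ≤ ∫⁻ t : ℝ, ENNReal.ofReal (Real.exp (-(1 / 2) * t ^ 2)) := by
          refine lintegral_mono fun t => ?_
          rw [lintegral_const_mul' _ _ ENNReal.ofReal_ne_top]
          refine (mul_le_mul_right (h t) _).trans_eq ?_
          rw [← ENNReal.ofReal_mul (Real.exp_pos _).le, ← Real.exp_add]
          congr 2; ring
      _ = ENNReal.ofReal (√(Real.pi / (1 / 2))) := by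
          rw [← integral_gaussian, ofReal_integral_eq_lintegral_ofReal
            (integrable_exp_neg_mul_sq (by norm_num))
            (Filter.Eventually.of_forall fun _ => (Real.exp_pos _).le)]
      -- The Gaussian e^{-t²} absorbs the subgaussian e^{t²/2}, leaving √(2π) ≤ 2√π.
      _ ≤ ENNReal.ofReal (2 * √Real.pi) := by
          apply ENNReal.ofReal_le_ofReal
          rw [Real.sqrt_le_left (by positivity), mul_pow, Real.sq_sqrt Real.pi_pos.le]
          nlinarith [Real.pi_pos]
      _ = _ := by rw [ENNReal.ofReal_mul zero_le_two]; simp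
  rwa [ENNReal.mul_le_mul_iff_left (by simpa using hpi) ENNReal.ofReal_ne_top] at main

lemma lintegral_exp_re_sq_le {n : ℕ → ℤ} (hn : ∀ k, ∑ j ∈ Finset.range k, |n j| < |n k|)
    (c : ℕ → ℂ) (K : ℕ) (hc : ∑ j ∈ Finset.range K, ‖c j‖ ^ 2 ≤ 1) :
    ∫⁻ x : UnitAddCircle, ENNReal.ofReal
      (Real.exp ((∑ j ∈ Finset.range K, c j * fourier (n j) x).re ^ 2 / 4)) ∂haarAddCircle ≤ 2 := by
  have hg : Continuous fun x : UnitAddCircle =>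
      (∑ j ∈ Finset.range K, c j * fourier (n j) x).re :=
    Complex.continuous_re.comp (continuous_finsetSum _ fun j _ =>
      continuous_const.mul (map_continuous (fourier (n j))))
  refine lintegral_exp_sq_le hg.measurable fun t => ?_
  have hint : Integrable (fun x : UnitAddCircle =>
      Real.exp (t * (∑ j ∈ Finset.range K, c j * fourier (n j) x).re)) haarAddCircle :=
    integrable_of_continuous (Real.continuous_exp.comp (continuous_const.mul hg))
  rw [← ofReal_integral_eq_lintegral_ofReal hint
    (Filter.Eventually.of_forall fun _ => (Real.exp_pos _).le)]
  exact ENNReal.ofReal_le_ofReal (integral_exp_lacunary_le hn c K hc t)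

/-- Lacunary sums are exponentially square integrable. -/
lemma integral_exp_norm_sq_le {n : ℕ → ℤ} (hn : ∀ k, ∑ j ∈ Finset.range k, |n j| < |n k|)
    (c : ℕ → ℂ) (K : ℕ) (hc : ∑ j ∈ Finset.range K, ‖c j‖ ^ 2 ≤ 1) :
    ∫ x : UnitAddCircle,
      Real.exp (‖∑ j ∈ Finset.range K, c j * fourier (n j) x‖ ^ 2 / 8) ∂haarAddCircle ≤ 4 := by
  have h1 := lintegral_exp_re_sq_le hn c K hc
  -- Multiplying by -i turns the imaginary part into a real part.
  have h2 := lintegral_exp_re_sq_le hn (fun j => -Complex.I * c j) K (by simpa using hc)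
  have hi : ∀ x : UnitAddCircle, (∑ j ∈ Finset.range K, -Complex.I * c j * fourier (n j) x).re =
      (∑ j ∈ Finset.range K, c j * fourier (n j) x).im := fun x => by
    simp_rw [mul_assoc, ← Finset.mul_sum]; simp
  simp_rw [hi] at h2
  have hgc : Continuous fun x : UnitAddCircle => ∑ j ∈ Finset.range K, c j * fourier (n j) x :=
    continuous_finsetSum _ fun j _ => continuous_const.mul (map_continuous (fourier (n j)))
  have hmeas : AEStronglyMeasurable (fun x : UnitAddCircle =>
      Real.exp (‖∑ j ∈ Finset.range K, c j * fourier (n j) x‖ ^ 2 / 8)) haarAddCircle :=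
    (Real.continuous_exp.comp ((hgc.norm.pow 2).div_const 8)).aestronglyMeasurable
  rw [integral_eq_lintegral_of_nonneg_ae
    (Filter.Eventually.of_forall fun _ => (Real.exp_pos _).le) hmeas]
  refine ENNReal.toReal_le_of_le_ofReal (by norm_num) ?_
  calc _ ≤ ∫⁻ x : UnitAddCircle,
        (ENNReal.ofReal (Real.exp ((∑ j ∈ Finset.range K, c j * fourier (n j) x).re ^ 2 / 4)) +
        ENNReal.ofReal (Real.exp ((∑ j ∈ Finset.range K, c j * fourier (n j) x).im ^ 2 / 4)))
          ∂haarAddCircle := by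
        refine lintegral_mono fun x => ?_
        set g := ∑ j ∈ Finset.range K, c j * fourier (n j) x
        simp only
        rw [← ENNReal.ofReal_add (Real.exp_pos _).le (Real.exp_pos _).le]
        apply ENNReal.ofReal_le_ofReal
        have hsq : ‖g‖ ^ 2 = g.re ^ 2 + g.im ^ 2 := by
          rw [← Complex.normSq_eq_norm_sq, Complex.normSq_apply]; ring
        -- ‖g‖² is at most twice the larger square, hence 8 in place of 4.
        rcases le_total (g.re ^ 2) (g.im ^ 2) with hle | hle
        · have : Real.exp (‖g‖ ^ 2 / 8) ≤ Real.exp (g.im ^ 2 / 4) :=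
            Real.exp_le_exp.mpr (by rw [hsq]; linarith)
          linarith [Real.exp_pos (g.re ^ 2 / 4)]
        · have : Real.exp (‖g‖ ^ 2 / 8) ≤ Real.exp (g.re ^ 2 / 4) :=
            Real.exp_le_exp.mpr (by rw [hsq]; linarith)
          linarith [Real.exp_pos (g.im ^ 2 / 4)]
    _ ≤ 2 + 2 := by
        rw [lintegral_add_left]
        · exact add_le_add h1 h2
        · exact (ENNReal.continuous_ofReal.comp (Real.continuous_exp.comp
            (((Complex.continuous_re.comp hgc).pow 2).div_const 4))).measurable
    _ = _ := by rw [show (2 : ℝ≥0∞) + 2 = 4 by norm_num]; simp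

/-! ### Zygmund's inequality -/

/-- A Young inequality for the dual pair L log^{1/2} L and exp L². Either v ≤ 4√log(1+u), or u and v
are both at most a constant times exp(v²/16). -/
lemma mul_le_log_add_exp {u v : ℝ} (hu : 0 ≤ u) (hv : 0 ≤ v) :
    u * v ≤ 4 * (u * Real.log (1 + u) ^ (1 / 2 : ℝ)) + 4 * Real.exp (v ^ 2 / 8) := by
  rw [← Real.sqrt_eq_rpow]
  have hp := Real.exp_pos (v ^ 2 / 8)
  rcases le_total v (4 * √(Real.log (1 + u))) with h | h
  · have := mul_le_mul_of_nonneg_left h hu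
    linarith
  · have hl : Real.log (1 + u) ≤ v ^ 2 / 16 := by
      have : Real.log (1 + u) ≤ (v / 4) ^ 2 :=
        (Real.sqrt_le_left (by positivity)).mp (by linarith)
      linarith
    have h1 : 1 + u ≤ Real.exp (v ^ 2 / 16) := (Real.log_le_iff_le_exp (by linarith)).mp hl
    have h2 : v ≤ 4 * Real.exp (v ^ 2 / 16) := by
      have := Real.add_one_le_exp (v ^ 2 / 16)
      nlinarith [sq_nonneg (v / 4 - 1)]
    have h3 : Real.exp (v ^ 2 / 8) = Real.exp (v ^ 2 / 16) * Real.exp (v ^ 2 / 16) := by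
      rw [← Real.exp_add]; congr 1; ring
    have h4 : u * v ≤ Real.exp (v ^ 2 / 16) * (4 * Real.exp (v ^ 2 / 16)) :=
      mul_le_mul (by linarith) h2 hv (Real.exp_pos _).le
    have h5 : 0 ≤ u * √(Real.log (1 + u)) := by positivity
    rw [h3]; linarith

/-- Zygmund's inequality for lacunary Fourier coefficients, uniform under translation of
the frequencies. -/
theorem exists_sum_sq_fourierCoeff_le {f : L1} (hf : f ∈ LlogL (1 / 2)) :
    ∃ C : ℝ, 0 ≤ C ∧ ∀ n : ℕ → ℤ, (∀ k, ∑ j ∈ Finset.range k, |n j| < |n k|) → ∀ (N : ℤ) (K : ℕ),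
      ∑ j ∈ Finset.range K, ‖fourierCoeff f (N + n j)‖ ^ 2 ≤ C := by
  set L := ∫ x, ‖f x‖ * Real.log (1 + ‖f x‖) ^ (1 / 2 : ℝ) ∂haarAddCircle with hL
  have hL0 : 0 ≤ L := integral_nonneg fun x => mul_nonneg (norm_nonneg _)
    (Real.rpow_nonneg (Real.log_nonneg (by simp)) _)
  have hf1 : Integrable f haarAddCircle := L1.integrable_coeFn f
  -- Pair f with a lacunary polynomial of ℓ² norm at most 1. The translation N enters only through a
  -- unimodular factor, so the bound does not see it; 16 is 4 times the exponential bound 4.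
  have dual : ∀ n : ℕ → ℤ, (∀ k, ∑ j ∈ Finset.range k, |n j| < |n k|) → ∀ (N : ℤ) (K : ℕ)
      (c : ℕ → ℂ), ∑ j ∈ Finset.range K, ‖c j‖ ^ 2 ≤ 1 →
      ‖∑ j ∈ Finset.range K, c j * fourierCoeff f (N + n j)‖ ≤ 4 * L + 16 := by
    intro n hn N K c hc
    have hgc : Continuous fun x : UnitAddCircle =>
        ∑ j ∈ Finset.range K, c j * fourier (-n j) x :=
      continuous_finsetSum _ fun j _ => continuous_const.mul (map_continuous (fourier (-n j)))
    have hexp : Integrable (fun x : UnitAddCircle =>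
        Real.exp (‖∑ j ∈ Finset.range K, c j * fourier (-n j) x‖ ^ 2 / 8)) haarAddCircle :=
      integrable_of_continuous (Real.continuous_exp.comp ((hgc.norm.pow 2).div_const 8))
    have e : ∑ j ∈ Finset.range K, c j * fourierCoeff f (N + n j) =
        ∫ x, (∑ j ∈ Finset.range K, c j * fourier (-n j) x) * (fourier (-N) x * f x)
          ∂haarAddCircle := by
      simp_rw [Finset.sum_mul]
      rw [integral_finsetSum]
      · refine Finset.sum_congr rfl fun j _ => ?_
        rw [fourierCoeff, ← integral_const_mul]
        congr 1; ext x
        rw [neg_add_rev, fourier_add, smul_eq_mul]; ring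
      · intro j _
        have := ((hf1.fourier_smul (-N)).fourier_smul (-n j)).const_mul (c j)
        refine this.congr (Filter.Eventually.of_forall fun x => ?_)
        simp only [smul_eq_mul]; ring
    rw [e]
    calc _ ≤ ∫ x, (4 * (‖f x‖ * Real.log (1 + ‖f x‖) ^ (1 / 2 : ℝ)) +
          4 * Real.exp (‖∑ j ∈ Finset.range K, c j * fourier (-n j) x‖ ^ 2 / 8))
            ∂haarAddCircle := by
          refine norm_integral_le_of_norm_le ((hf.const_mul 4).add (hexp.const_mul 4))
            (Filter.Eventually.of_forall fun x => ?_)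
          rw [norm_mul, norm_mul, fourier_apply, Circle.norm_coe, one_mul, mul_comm]
          exact mul_le_log_add_exp (norm_nonneg _) (norm_nonneg _)
      _ = 4 * L + 4 * ∫ x : UnitAddCircle,
            Real.exp (‖∑ j ∈ Finset.range K, c j * fourier (-n j) x‖ ^ 2 / 8) ∂haarAddCircle := by
          rw [integral_add (hf.const_mul 4) (hexp.const_mul 4), integral_const_mul,
            integral_const_mul]
      _ ≤ _ := by
          have := integral_exp_norm_sq_le (n := fun j => -n j) (by simpa using hn) c K hc
          linarith
  refine ⟨(4 * L + 16) ^ 2, sq_nonneg _, fun n hn N K => ?_⟩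
  set S := ∑ j ∈ Finset.range K, ‖fourierCoeff f (N + n j)‖ ^ 2 with hS
  have hS0 : 0 ≤ S := Finset.sum_nonneg fun _ _ => sq_nonneg _
  rcases hS0.eq_or_lt with h0 | hpos
  · rw [← h0]; positivity
  have hsq : 0 < √S := Real.sqrt_pos.mpr hpos
  -- The extremal choice: this unit vector makes the pairing equal to √S.
  have h := dual n hn N K (fun j => (starRingEnd ℂ) (fourierCoeff f (N + n j)) / (√S : ℂ)) (by
    simp only [norm_div, RCLike.norm_conj, Complex.norm_real, Real.norm_eq_abs, div_pow, sq_abs,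
      Real.sq_sqrt hS0]
    rw [← Finset.sum_div, ← hS, div_self hpos.ne'])
  have e : ∑ j ∈ Finset.range K, (starRingEnd ℂ) (fourierCoeff f (N + n j)) / (√S : ℂ) *
      fourierCoeff f (N + n j) = ((S / √S : ℝ) : ℂ) := by
    rw [Complex.ofReal_div, hS, Complex.ofReal_sum, Finset.sum_div]
    refine Finset.sum_congr rfl fun j _ => ?_
    rw [div_mul_eq_mul_div, Complex.conj_mul']
    push_cast; rfl
  rw [e, Real.div_sqrt, Complex.norm_real, Real.norm_of_nonneg hsq.le] at h
  exact (Real.sqrt_le_left (by positivity)).mp h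


/-! ### Dyadic boundedness suffices for L log^{1/2} L -/

/-- The square sums of `m` over all dyadic blocks of frequencies are uniformly bounded. -/
def DyadicallyBounded (m : ℤ → ℂ) : Prop :=
  ∀ s : ℤ, |s| = 1 → ∃ B : ℝ, ∀ k : ℕ,
    ∑ n ∈ Finset.Ico (2 ^ k) (2 ^ (k + 1)), ‖m (s * (n : ℕ))‖ ^ 2 ≤ B

/-- Using every second block makes the growth ratio of the lower bounds 4, and the geometric sum of
the upper bounds stays below the next lower bound. Consecutive blocks would not do: 1, 3, 4 fails.
-/
lemma sum_abs_lt_of_dyadic {n : ℕ → ℤ} {p : ℕ}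
    (hn : ∀ k, 2 ^ (2 * k + p) ≤ |n k| ∧ |n k| < 2 ^ (2 * k + p + 1)) (k : ℕ) :
    ∑ j ∈ Finset.range k, |n j| < |n k| := by
  refine lt_of_lt_of_le ?_ (hn k).1
  induction k with
  | zero => simp
  | succ k ih =>
    rw [Finset.sum_range_succ]
    have h := (hn k).2
    have e : (2 : ℤ) ^ (2 * (k + 1) + p) = 2 ^ (2 * k + p) * 4 := by ring
    have hp : (0 : ℤ) < 2 ^ (2 * k + p) := by positivity
    rw [pow_succ] at h
    omega

lemma sum_range_two_mul (a : ℕ → ℝ) (K : ℕ) : ∑ k ∈ Finset.range (2 * K), a k =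
    ∑ k ∈ Finset.range K, a (2 * k) + ∑ k ∈ Finset.range K, a (2 * k + 1) := by
  induction K with
  | zero => simp
  | succ K ih =>
    rw [show 2 * (K + 1) = 2 * K + 1 + 1 by ring, Finset.sum_range_succ, Finset.sum_range_succ, ih,
      Finset.sum_range_succ, Finset.sum_range_succ]
    ring

lemma sum_range_two_pow (a : ℕ → ℝ) (K : ℕ) : ∑ n ∈ Finset.range (2 ^ K), a n =
    a 0 + ∑ k ∈ Finset.range K, ∑ n ∈ Finset.Ico (2 ^ k) (2 ^ (k + 1)), a n := by
  induction K with
  | zero => simp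
  | succ K ih =>
    rw [Finset.sum_range_succ, ← add_assoc, ← ih, Finset.range_eq_Ico, Finset.range_eq_Ico,
      Finset.sum_Ico_consecutive _ (Nat.zero_le _) (Nat.pow_le_pow_right two_pos K.le_succ)]

/-- The largest Fourier coefficients of an `L log^{1/2} L` function over dyadic blocks are square
summable. -/
lemma exists_dyadic_max_bound {f : L1} (hf : f ∈ LlogL (1 / 2)) {s : ℤ} (hs : |s| = 1) :
    ∃ (C : ℝ) (a : ℕ → ℝ), (∀ k, 0 ≤ a k) ∧ (∀ K, ∑ k ∈ Finset.range K, a k ≤ C) ∧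
      ∀ k, ∀ n ∈ Finset.Ico (2 ^ k) (2 ^ (k + 1)), ‖fourierCoeff f (s * (n : ℕ))‖ ^ 2 ≤ a k := by
  obtain ⟨C, hC0, hC⟩ := exists_sum_sq_fourierCoeff_le hf
  have hmax : ∀ k : ℕ, ∃ N ∈ Finset.Ico (2 ^ k) (2 ^ (k + 1)),
      ∀ n ∈ Finset.Ico (2 ^ k) (2 ^ (k + 1)),
        ‖fourierCoeff f (s * (n : ℕ))‖ ^ 2 ≤ ‖fourierCoeff f (s * (N : ℕ))‖ ^ 2 := fun k =>
    Finset.exists_max_image _ _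
      (Finset.nonempty_Ico.mpr (Nat.pow_lt_pow_right one_lt_two k.lt_succ_self))
  choose N hN hNmax using hmax
  refine ⟨2 * C, fun k => ‖fourierCoeff f (s * N k)‖ ^ 2, fun _ => sq_nonneg _, fun K => ?_, hNmax⟩
  -- Even and odd blocks are treated separately, each giving a superincreasing sequence.
  have hp : ∀ p : ℕ, ∑ k ∈ Finset.range K, ‖fourierCoeff f (s * N (2 * k + p))‖ ^ 2 ≤ C := by
    intro p
    have := hC (fun k => s * N (2 * k + p)) (sum_abs_lt_of_dyadic (p := p) fun k => by
      have := Finset.mem_Ico.mp (hN (2 * k + p))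
      rw [abs_mul, hs, one_mul, Nat.abs_cast]
      exact_mod_cast this) 0 K
    simpa using this
  calc _ ≤ ∑ k ∈ Finset.range (2 * K), ‖fourierCoeff f (s * N k)‖ ^ 2 :=
        Finset.sum_le_sum_of_subset_of_nonneg (Finset.range_mono (by omega))
          fun _ _ _ => sq_nonneg _
    _ ≤ _ := by
        rw [sum_range_two_mul]
        have h0 := hp 0
        have h1 := hp 1
        simp only [add_zero] at h0
        linarith

lemma summable_of_dyadicallyBounded {m : ℤ → ℂ} (hm : DyadicallyBounded m) {f : L1}
    (hf : f ∈ LlogL (1 / 2)) {s : ℤ} (hs : |s| = 1) :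
    Summable fun n : ℕ => ‖m (s * n) * fourierCoeff f (s * n)‖ ^ 2 := by
  obtain ⟨B, hB⟩ := hm s hs
  obtain ⟨C, a, ha0, haC, ha⟩ := exists_dyadic_max_bound hf hs
  have hB0 : 0 ≤ B := (Finset.sum_nonneg fun _ _ => sq_nonneg _).trans (hB 0)
  -- Frequency 0 lies in no dyadic block and is counted apart.
  refine summable_of_sum_range_le (c := ‖m (s * (0 : ℕ)) * fourierCoeff f (s * (0 : ℕ))‖ ^ 2 + B * C)
    (fun _ => sq_nonneg _) fun K => ?_
  refine (Finset.sum_le_sum_of_subset_of_nonneg (Finset.range_mono K.lt_two_pow_self.le)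
    fun _ _ _ => sq_nonneg _).trans ?_
  rw [sum_range_two_pow]
  gcongr
  calc _ ≤ ∑ k ∈ Finset.range K, B * a k := by
        refine Finset.sum_le_sum fun k _ => ?_
        calc _ ≤ ∑ n ∈ Finset.Ico (2 ^ k) (2 ^ (k + 1)), ‖m (s * (n : ℕ))‖ ^ 2 * a k := by
              refine Finset.sum_le_sum fun n hn => ?_
              rw [norm_mul, mul_pow]
              exact mul_le_mul_of_nonneg_left (ha k n hn) (sq_nonneg _)
          _ ≤ _ := by
              rw [← Finset.sum_mul]
              exact mul_le_mul_of_nonneg_right (hB k) (ha0 k)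
    _ ≤ _ := by
        rw [← Finset.mul_sum]
        exact mul_le_mul_of_nonneg_left (haC K) hB0

theorem mem_multipliers_LlogL_of_dyadicallyBounded {m : ℤ → ℂ} (hm : Memℓp m ∞)
    (hd : DyadicallyBounded m) : m ∈ multipliers (LlogL (1 / 2)) := by
  refine ⟨hm, fun f hf => Summable.of_nat_of_neg ?_ ?_⟩
  · simpa using summable_of_dyadicallyBounded hd hf (s := 1) (by simp)
  · simpa using summable_of_dyadicallyBounded hd hf (s := -1) (by simp)

/-! ### Dyadic boundedness is necessary for H¹ -/

/-- The Fourier coefficient as a continuous functional on `L¹`. -/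
noncomputable def fourierCoeffCLM (n : ℤ) : L1 →L[ℂ] ℂ :=
  LinearMap.mkContinuous
    { toFun := fun f => fourierCoeff f n
      map_add' := fun f g => by
        rw [fourierCoeff_congr_ae (Lp.coeFn_add f g),
          fourierCoeff.add (L1.integrable_coeFn f) (L1.integrable_coeFn g), Pi.add_apply]
      map_smul' := fun c f => by
        rw [fourierCoeff_congr_ae (Lp.coeFn_smul c f), fourierCoeff.const_smul, RingHom.id_apply] }
    1 fun f => by
      rw [one_mul, L1.norm_eq_integral_norm]
      refine norm_integral_le_of_norm_le (L1.integrable_coeFn f).norm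
        (Filter.Eventually.of_forall fun x => ?_)
      rw [norm_smul, fourier_apply, Circle.norm_coe, one_mul]

lemma fourierCoeffCLM_apply (n : ℤ) (f : L1) : fourierCoeffCLM n f = fourierCoeff f n := rfl

/-- Condensation: a function whose nonnegative coefficients dominate those of a whole sequence. -/
lemma exists_dominating_coeff (F : ℕ → L1) (hF : ∀ j, ‖F j‖ ≤ 1) (r : ℕ → ℤ → ℝ)
    (hr0 : ∀ j n, 0 ≤ r j n) (hr : ∀ j n, fourierCoeff (F j) n = r j n) :
    ∃ f : L1, ∃ ρ : ℤ → ℝ, (∀ n, fourierCoeff f n = ρ n) ∧ (∀ n, (∀ j, r j n = 0) → ρ n = 0) ∧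
      ∀ j n, (1 / 2) ^ j * r j n ≤ ρ n := by
  -- The weights 2^{-j} give convergence in L¹; nonnegative coefficients rule out cancellation.
  have hsum : Summable fun j => ((1 / 2 : ℂ) ^ j) • F j := by
    refine Summable.of_norm_bounded summable_geometric_two fun j => ?_
    rw [norm_smul, norm_pow]
    have : ‖(1 / 2 : ℂ)‖ = 1 / 2 := by norm_num
    rw [this]
    exact mul_le_of_le_one_right (by positivity) (hF j)
  have hs : ∀ n, HasSum (fun j => (((1 / 2) ^ j * r j n : ℝ) : ℂ))
      (fourierCoeff (∑' j, ((1 / 2 : ℂ) ^ j) • F j : L1) n) := by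
    intro n
    have h := (fourierCoeffCLM n).hasSum hsum.hasSum
    rw [fourierCoeffCLM_apply] at h
    refine h.congr_fun fun j => ?_
    simp [fourierCoeffCLM_apply, hr]
  have hsr : ∀ n, Summable fun j => (1 / 2) ^ j * r j n := fun n =>
    Complex.summable_ofReal.mp (hs n).summable
  refine ⟨∑' j, ((1 / 2 : ℂ) ^ j) • F j, fun n => ∑' j, (1 / 2) ^ j * r j n, fun n => ?_,
    fun n h => by simp [h], fun j n => (hsr n).le_tsum j fun i _ =>
      mul_nonneg (by positivity) (hr0 i n)⟩
  rw [← (hs n).tsum_eq, Complex.ofReal_tsum]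

/-- The Dirichlet-type kernel `∑_{0 ≤ j < N} e_{sj}`. -/
noncomputable def dirichletSum (s : ℤ) (N : ℕ) : C(UnitAddCircle, ℂ) :=
  ∑ j ∈ Finset.range N, fourier (s * j)

/-- The Fejér kernel, translated in frequency to have spectrum on one side. -/
noncomputable def shiftedFejer (s : ℤ) (N : ℕ) : C(UnitAddCircle, ℂ) :=
  (N : ℂ)⁻¹ • (fourier s * dirichletSum s N * dirichletSum s N)

lemma integral_fourier_mul_fourier (a b : ℤ) :
    ∫ x : UnitAddCircle, fourier a x * fourier b x ∂haarAddCircle = if a + b = 0 then 1 else 0 := by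
  have h : fourierCoeff (T := 1) (fourier b) (-a) = if a + b = 0 then 1 else 0 := by
    rw [fourierCoeff_fourier, Pi.single_apply]
    exact if_congr (by omega) rfl rfl
  rw [← h, fourierCoeff, neg_neg]
  rfl

lemma integral_norm_sq_dirichletSum {s : ℤ} (hs : s ≠ 0) (N : ℕ) :
    ∫ x, ‖dirichletSum s N x‖ ^ 2 ∂haarAddCircle = N := by
  have e : ∀ x, ((‖dirichletSum s N x‖ ^ 2 : ℝ) : ℂ) = ∑ i ∈ Finset.range N, ∑ j ∈ Finset.range N,
      fourier (-(s * i)) x * fourier (s * j) x := by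
    intro x
    rw [Complex.ofReal_pow, ← Complex.conj_mul', dirichletSum, ContinuousMap.sum_apply, map_sum,
      Finset.sum_mul_sum]
    simp_rw [fourier_neg]
  have h : ∫ x, ((‖dirichletSum s N x‖ ^ 2 : ℝ) : ℂ) ∂haarAddCircle = N := by
    have hint : ∀ a b : ℤ, Integrable (fun x : UnitAddCircle => fourier a x * fourier b x)
        haarAddCircle := fun a b => integrable_of_continuous
      ((map_continuous (fourier a)).mul (map_continuous (fourier b)))
    simp_rw [e]
    rw [integral_finsetSum _ fun i _ => integrable_finsetSum _ fun j _ => hint _ _]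
    rw [Finset.sum_congr rfl fun i hi => show _ = (1 : ℂ) from ?_]
    · simp
    rw [integral_finsetSum _ fun j _ => hint _ _]
    simp_rw [integral_fourier_mul_fourier]
    rw [Finset.sum_eq_single_of_mem i hi]
    · simp
    · intro j _ hj
      rw [if_neg]
      intro h0
      have : s * ((j : ℤ) - i) = 0 := by linarith
      rcases mul_eq_zero.mp this with h1 | h1
      · exact hs h1
      · exact hj (by omega)
  rw [integral_complex_ofReal] at h
  exact_mod_cast h

lemma integral_norm_shiftedFejer_le {s : ℤ} (hs : s ≠ 0) (N : ℕ) :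
    ∫ x, ‖shiftedFejer s N x‖ ∂haarAddCircle ≤ 1 := by
  have e : ∀ x, ‖shiftedFejer s N x‖ = (N : ℝ)⁻¹ * ‖dirichletSum s N x‖ ^ 2 := by
    intro x
    simp only [shiftedFejer, ContinuousMap.smul_apply, ContinuousMap.mul_apply, norm_smul,
      norm_mul, fourier_apply, Circle.norm_coe, norm_inv, Complex.norm_natCast]
    ring
  simp_rw [e]
  rw [integral_const_mul, integral_norm_sq_dirichletSum hs]
  exact inv_mul_le_one

/-- The Fourier coefficients of `shiftedFejer`, as a normalized count of representations. -/
noncomputable def fejerCoeff (s : ℤ) (N : ℕ) (m : ℤ) : ℝ :=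
  (N : ℝ)⁻¹ * ∑ i ∈ Finset.range N, ∑ j ∈ Finset.range N,
    if m = s * (i + j + 1) then (1 : ℝ) else 0

lemma fejerCoeff_nonneg (s : ℤ) (N : ℕ) (m : ℤ) : 0 ≤ fejerCoeff s N m :=
  mul_nonneg (by positivity) (Finset.sum_nonneg fun i _ => Finset.sum_nonneg fun j _ => by
    split_ifs <;> simp)

lemma fourierCoeff_shiftedFejer (s : ℤ) (N : ℕ) (m : ℤ) :
    fourierCoeff (shiftedFejer s N) m = fejerCoeff s N m := by
  rw [fejerCoeff]
  have e : (shiftedFejer s N : UnitAddCircle → ℂ) = fun x => (N : ℂ)⁻¹ *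
      (∑ i ∈ Finset.range N, ∑ j ∈ Finset.range N,
        (fourier (s * (i + j + 1)) : UnitAddCircle → ℂ)) x := by
    ext x
    simp only [shiftedFejer, dirichletSum, ContinuousMap.smul_apply, ContinuousMap.mul_apply,
      ContinuousMap.sum_apply, Finset.sum_apply, smul_eq_mul, mul_assoc, Finset.sum_mul_sum]
    congr 1
    rw [Finset.mul_sum]
    refine Finset.sum_congr rfl fun i _ => ?_
    rw [Finset.mul_sum]
    refine Finset.sum_congr rfl fun j _ => ?_
    rw [← fourier_add, ← fourier_add]
    congr 2; ring
  have hint : ∀ a : ℤ, Integrable (fourier a : UnitAddCircle → ℂ) haarAddCircle := fun a =>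
    integrable_of_continuous (map_continuous (fourier a))
  rw [e, fourierCoeff.const_mul, fourierCoeff.sum _ _ fun i _ =>
    integrable_finsetSum' _ fun j _ => hint _]
  rw [Finset.sum_apply, Complex.ofReal_mul, Complex.ofReal_inv, Complex.ofReal_natCast,
    Complex.ofReal_sum]
  congr 1
  refine Finset.sum_congr rfl fun i _ => ?_
  rw [fourierCoeff.sum _ _ fun j _ => hint _, Finset.sum_apply, Complex.ofReal_sum]
  refine Finset.sum_congr rfl fun j _ => ?_
  rw [fourierCoeff_fourier, Pi.single_apply]
  split_ifs <;> simp

/-- On each signed dyadic block there is a one-sided function of unit `L¹` norm whose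
Fourier coefficients are nonnegative, and at least `1/2` on the block. -/
lemma exists_block_function {s : ℤ} (hs : |s| = 1) (k : ℕ) :
    ∃ F : L1, ∃ r : ℤ → ℝ, ‖F‖ ≤ 1 ∧ (∀ n, 0 ≤ r n) ∧ (∀ n, fourierCoeff F n = r n) ∧
      (∀ n, s * n ≤ 0 → r n = 0) ∧
      ∀ n ∈ Finset.Ico (2 ^ k) (2 ^ (k + 1)), 1 / 2 ≤ r (s * (n : ℕ)) := by
  have hs0 : s ≠ 0 := by rintro rfl; simp at hs
  have hss : s * s = 1 := by rw [← abs_mul_abs_self, hs, one_mul]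
  -- For 1 ≤ n ≤ N, n = i + j + 1 has n solutions with i, j < N, so the coefficient at s n is n/N,
  -- at least 1/2 once n ≥ N/2 = 2^k. The 1 comes from the extra factor `fourier s`, which also
  -- excludes frequency 0.
  set N : ℕ := 2 ^ (k + 1) with hN
  have hae := ContinuousMap.coeFn_toLp (E := ℂ) (p := 1) (𝕜 := ℂ)
    (haarAddCircle : Measure UnitAddCircle) (shiftedFejer s N)
  refine ⟨ContinuousMap.toLp (E := ℂ) 1 haarAddCircle ℂ (shiftedFejer s N), fejerCoeff s N,
    ?_, fejerCoeff_nonneg s N, fun n => ?_, fun n hn => ?_, fun n hn => ?_⟩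
  · rw [L1.norm_eq_integral_norm, integral_congr_ae (hae.mono fun x hx => by rw [hx])]
    exact integral_norm_shiftedFejer_le hs0 N
  · rw [fourierCoeff_congr_ae hae, fourierCoeff_shiftedFejer]
  · rw [fejerCoeff, Finset.sum_eq_zero, mul_zero]
    intro i _
    refine Finset.sum_eq_zero fun j _ => if_neg ?_
    rintro rfl
    rw [← mul_assoc, hss] at hn
    omega
  · rw [Finset.mem_Ico] at hn
    have hNpos : (0 : ℝ) < N := by positivity
    have h2 : N = 2 * 2 ^ k := by rw [hN, pow_succ]; ring
    have hcount : (n : ℝ) ≤ ∑ i ∈ Finset.range N, ∑ j ∈ Finset.range N,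
        if s * (n : ℤ) = s * (i + j + 1) then (1 : ℝ) else 0 := by
      calc (n : ℝ) = ∑ i ∈ Finset.range n, (1 : ℝ) := by simp
        _ ≤ ∑ i ∈ Finset.range n, ∑ j ∈ Finset.range N,
            if s * (n : ℤ) = s * (i + j + 1) then (1 : ℝ) else 0 := by
            refine Finset.sum_le_sum fun i hi => ?_
            rw [Finset.mem_range] at hi
            have hmem : n - 1 - i ∈ Finset.range N := Finset.mem_range.mpr (by omega)
            refine le_trans ?_ (Finset.single_le_sum (fun j _ => ?_) hmem)
            · rw [if_pos]
              congr 1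
              omega
            · split_ifs <;> simp
        _ ≤ _ := Finset.sum_le_sum_of_subset_of_nonneg (Finset.range_mono hn.2.le) fun i _ _ =>
            Finset.sum_nonneg fun j _ => by split_ifs <;> simp
    have hn2 : (N : ℝ) ≤ 2 * n := by exact_mod_cast (by omega : N ≤ 2 * n)
    rw [fejerCoeff, inv_mul_eq_div, le_div_iff₀ hNpos]
    linarith

/-- On a one-sided spectrum omitting 0, the Hilbert transform is multiplication by the constant -i
s. -/
lemma mem_hardySpace_of_oneSided {f : L1} {s : ℤ} (hs : |s| = 1)
    (hf : ∀ n, s * n ≤ 0 → fourierCoeff f n = 0) : f ∈ hardySpace := by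
  refine ⟨(-Complex.I * s) • f, fun n => ?_⟩
  rw [fourierCoeff_congr_ae (Lp.coeFn_smul _ f), fourierCoeff.const_smul, smul_eq_mul]
  rcases le_or_gt (s * n) 0 with h | h
  · rw [hf n h]; simp
  · have : n.sign = s := by
      rcases (abs_eq zero_le_one).mp hs with rfl | rfl
      · exact Int.sign_eq_one_of_pos (by omega)
      · exact Int.sign_eq_neg_one_of_neg (by omega)
    rw [this]

theorem dyadicallyBounded_of_mem_multipliers_hardySpace {m : ℤ → ℂ}
    (hm : m ∈ multipliers hardySpace) : DyadicallyBounded m := by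
  intro s hs
  by_contra! hcon
  -- The weights 2^{-j} cost 4^{-j} after squaring; against 16^j the block sums still grow like 4^j.
  choose k hk using fun j : ℕ => hcon (16 ^ j)
  choose F r hF hr0 hr hrs hrb using fun j => exists_block_function hs (k j)
  obtain ⟨f, ρ, hfρ, hρ0, hρ⟩ := exists_dominating_coeff F hF r hr0 hr
  have hH : f ∈ hardySpace := mem_hardySpace_of_oneSided hs fun n hn => by
    rw [hfρ, hρ0 n fun j => hrs j n hn, Complex.ofReal_zero]
  have hs0 : s ≠ 0 := by rintro rfl; simp at hs
  have hsum : Summable fun n : ℕ => ‖m (s * n) * fourierCoeff f (s * n)‖ ^ 2 :=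
    (hm.2 f hH).comp_injective (i := fun n : ℕ => s * (n : ℤ)) fun a b hab => by
      exact_mod_cast mul_left_cancel₀ hs0 hab
  set T := ∑' n : ℕ, ‖m (s * n) * fourierCoeff f (s * n)‖ ^ 2
  have hT : ∀ j : ℕ, (4 : ℝ) ^ j ≤ 4 * T := by
    intro j
    have h1 : ∑ n ∈ Finset.Ico (2 ^ k j) (2 ^ (k j + 1)), ‖m (s * (n : ℕ))‖ ^ 2 * ((1 / 4) ^ j / 4)
        ≤ T := by
      refine le_trans (Finset.sum_le_sum fun n hn => ?_)
        (hsum.sum_le_tsum (Finset.Ico (2 ^ k j) (2 ^ (k j + 1))) fun _ _ => sq_nonneg _)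
      rw [norm_mul, mul_pow, hfρ, Complex.norm_real, Real.norm_eq_abs, sq_abs]
      refine mul_le_mul_of_nonneg_left ?_ (sq_nonneg _)
      have h2 : (1 / 2 : ℝ) ^ j * (1 / 2) ≤ ρ (s * n) :=
        (mul_le_mul_of_nonneg_left (hrb j n hn) (by positivity)).trans (hρ j _)
      calc (1 / 4 : ℝ) ^ j / 4 = ((1 / 2) ^ j * (1 / 2)) ^ 2 := by
            rw [mul_pow, ← pow_mul, mul_comm j 2, pow_mul]; norm_num; ring
        _ ≤ _ := pow_le_pow_left₀ (by positivity) h2 2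
    rw [← Finset.sum_mul] at h1
    have h3 := mul_le_mul_of_nonneg_right (hk j).le (show (0 : ℝ) ≤ (1 / 4) ^ j / 4 by positivity)
    have h4 : (16 : ℝ) ^ j * ((1 / 4) ^ j / 4) = 4 ^ j / 4 := by
      rw [← mul_div_assoc, ← mul_pow]; norm_num
    linarith
  obtain ⟨j, hj⟩ := pow_unbounded_of_one_lt (4 * T) (show (1 : ℝ) < 4 by norm_num)
  exact absurd (hT j) (not_le.mpr hj)

/-! ### A multiplier separating the two classes -/

/-- A translate of the first powers of two. -/
def lacunaryBlock (L : ℕ) : Finset ℤ :=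
  (Finset.range L).image fun j : ℕ => 2 ^ L + 2 ^ j

/-- The square of the multiplier that separates the two classes. -/
noncomputable def separatingWeight (n : ℤ) : ℝ :=
  ∑' k : ℕ, (1 / 4) ^ k * if n ∈ lacunaryBlock (16 ^ k) then 1 else 0

lemma summable_separatingWeight (n : ℤ) :
    Summable fun k : ℕ => (1 / 4 : ℝ) ^ k * if n ∈ lacunaryBlock (16 ^ k) then 1 else 0 := by
  refine Summable.of_nonneg_of_le (fun k => ?_) (fun k => ?_)
    (summable_geometric_of_lt_one (r := 1 / 4) (by norm_num) (by norm_num))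
  · split_ifs <;> positivity
  · split_ifs <;> simp

lemma separatingWeight_nonneg (n : ℤ) : 0 ≤ separatingWeight n :=
  tsum_nonneg fun k => by split_ifs <;> positivity

lemma separatingWeight_le (n : ℤ) : separatingWeight n ≤ 4 / 3 := by
  have h := (summable_separatingWeight n).tsum_le_tsum (g := fun k : ℕ => (1 / 4 : ℝ) ^ k)
    (fun k => by split_ifs <;> simp)
    (summable_geometric_of_lt_one (by norm_num) (by norm_num))
  rw [tsum_geometric_of_lt_one (by norm_num) (by norm_num)] at h
  exact h.trans (by norm_num)

lemma le_separatingWeight {k : ℕ} {n : ℤ} (h : n ∈ lacunaryBlock (16 ^ k)) :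
    (1 / 4) ^ k ≤ separatingWeight n := by
  have := (summable_separatingWeight n).le_tsum k fun i _ => by split_ifs <;> positivity
  simpa only [h, if_true, mul_one, separatingWeight] using this

lemma norm_sqrt_separatingWeight_sq (n : ℤ) :
    ‖((√(separatingWeight n) : ℝ) : ℂ)‖ ^ 2 = separatingWeight n := by
  rw [Complex.norm_real, Real.norm_eq_abs, sq_abs, Real.sq_sqrt (separatingWeight_nonneg n)]

lemma two_pow_superincreasing (k : ℕ) :
    ∑ j ∈ Finset.range k, |(2 : ℤ) ^ j| < |(2 : ℤ) ^ k| := by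
  simp only [abs_pow, abs_two]
  induction k with
  | zero => simp
  | succ k ih => rw [Finset.sum_range_succ, pow_succ]; omega

/-- Each block is a translated lacunary set, so Zygmund's bound holds with one constant for all of
them, and the weights 4^{-k} are summable. -/
lemma separating_mem_multipliers :
    (fun n => ((√(separatingWeight n) : ℝ) : ℂ)) ∈ multipliers (LlogL (1 / 2)) := by
  refine ⟨memℓp_infty ⟨√(4 / 3), ?_⟩, fun f hf => ?_⟩
  · rintro _ ⟨n, rfl⟩
    simp only [Complex.norm_real, Real.norm_of_nonneg (Real.sqrt_nonneg _)]
    exact Real.sqrt_le_sqrt (separatingWeight_le n)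
  obtain ⟨C, hC0, hC⟩ := exists_sum_sq_fourierCoeff_le hf
  simp_rw [norm_mul, mul_pow, norm_sqrt_separatingWeight_sq]
  have hblock : ∀ (L : ℕ) (u : Finset ℤ),
      ∑ n ∈ u, (if n ∈ lacunaryBlock L then 1 else 0) * ‖fourierCoeff f n‖ ^ 2 ≤ C := by
    intro L u
    simp only [ite_mul, one_mul, zero_mul]
    rw [← Finset.sum_filter]
    calc _ ≤ ∑ n ∈ lacunaryBlock L, ‖fourierCoeff f n‖ ^ 2 :=
          Finset.sum_le_sum_of_subset_of_nonneg (fun n hn => (Finset.mem_filter.mp hn).2)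
            fun _ _ _ => sq_nonneg _
      _ = ∑ j ∈ Finset.range L, ‖fourierCoeff f (2 ^ L + 2 ^ j)‖ ^ 2 := by
          rw [lacunaryBlock, Finset.sum_image]
          intro i _ j _ hij
          exact Int.pow_right_injective (le_refl 2) (add_left_cancel hij)
      _ ≤ C := hC (fun j => 2 ^ j) two_pow_superincreasing (2 ^ L) L
  have hgeo : Summable fun k : ℕ => (1 / 4 : ℝ) ^ k * C :=
    (summable_geometric_of_lt_one (by norm_num) (by norm_num)).mul_right C
  refine summable_of_sum_le (c := ∑' k : ℕ, (1 / 4 : ℝ) ^ k * C)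
    (fun n => mul_nonneg (separatingWeight_nonneg n) (sq_nonneg _)) fun u => ?_
  have hs : ∀ n, Summable fun k : ℕ => (1 / 4 : ℝ) ^ k *
      (if n ∈ lacunaryBlock (16 ^ k) then 1 else 0) * ‖fourierCoeff f n‖ ^ 2 := fun n =>
    (summable_separatingWeight n).mul_right _
  simp_rw [separatingWeight, ← tsum_mul_right]
  rw [← Summable.tsum_finsetSum fun n _ => hs n]
  refine Summable.tsum_le_tsum (fun k => ?_) (summable_sum fun n _ => hs n) hgeo
  simp_rw [mul_assoc]
  rw [← Finset.mul_sum]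
  exact mul_le_mul_of_nonneg_left (hblock _ u) (by positivity)

/-- All 16^k points of the k-th set lie in one dyadic block, each with weight at least 4^{-k}, so
the block sum is at least 4^k. -/
lemma separating_not_dyadicallyBounded :
    ¬ DyadicallyBounded fun n => ((√(separatingWeight n) : ℝ) : ℂ) := by
  intro h
  obtain ⟨B, hB⟩ := h 1 (by simp)
  obtain ⟨k, hk⟩ := pow_unbounded_of_one_lt B (show (1 : ℝ) < 4 by norm_num)
  have hb := hB (16 ^ k)
  simp only [one_mul, norm_sqrt_separatingWeight_sq] at hb
  have hinj : Set.InjOn (fun j : ℕ => 2 ^ (16 ^ k) + 2 ^ j) (Finset.range (16 ^ k) : Set ℕ) :=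
    fun i _ j _ hij => Nat.pow_right_injective (le_refl 2) (add_left_cancel hij)
  have hsub : (Finset.range (16 ^ k)).image (fun j : ℕ => 2 ^ (16 ^ k) + 2 ^ j) ⊆
      Finset.Ico (2 ^ (16 ^ k)) (2 ^ (16 ^ k + 1)) := by
    intro n hn
    obtain ⟨j, hj, rfl⟩ := Finset.mem_image.mp hn
    have := Nat.pow_lt_pow_right one_lt_two (Finset.mem_range.mp hj)
    rw [Finset.mem_Ico, pow_succ]
    exact ⟨Nat.le_add_right _ _, by linarith⟩
  have h1 : (4 : ℝ) ^ k ≤ B := by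
    calc (4 : ℝ) ^ k = ∑ j ∈ Finset.range (16 ^ k), (1 / 4 : ℝ) ^ k := by
          rw [Finset.sum_const, Finset.card_range, nsmul_eq_mul, Nat.cast_pow, ← mul_pow]
          norm_num
      _ ≤ ∑ j ∈ Finset.range (16 ^ k), separatingWeight ((2 ^ (16 ^ k) + 2 ^ j : ℕ) : ℤ) := by
          refine Finset.sum_le_sum fun j hj => le_separatingWeight ?_
          rw [lacunaryBlock, Finset.mem_image]
          exact ⟨j, hj, by push_cast; rfl⟩
      _ = ∑ n ∈ (Finset.range (16 ^ k)).image (fun j : ℕ => 2 ^ (16 ^ k) + 2 ^ j),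
            separatingWeight (n : ℕ) := by rw [Finset.sum_image hinj]
      _ ≤ _ := (Finset.sum_le_sum_of_subset_of_nonneg hsub fun _ _ _ =>
            separatingWeight_nonneg _).trans hb
  linarith

end TorusMultiplier

theorem theorem4p1 :
    TorusMultiplier.multipliers TorusMultiplier.hardySpace ⊂
      TorusMultiplier.multipliers (TorusMultiplier.LlogL (1 / 2)) :=
  ⟨fun _ hm => TorusMultiplier.mem_multipliers_LlogL_of_dyadicallyBounded hm.1
    (TorusMultiplier.dyadicallyBounded_of_mem_multipliers_hardySpace hm),
  fun h => TorusMultiplier.separating_not_dyadicallyBounded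
    (TorusMultiplier.dyadicallyBounded_of_mem_multipliers_hardySpace
      (h TorusMultiplier.separating_mem_multipliers))⟩
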